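/- Let $R$ be a commutative noetherian ring and let $I,J$ be ideals of $R$. For an $R$-module $M$ put $$\Gamma_{I,J}(M)=\{x\in M \mid I^n x\subseteq Jx \text{ for some } n\in\mathbb N\},\qquad Jx=\{jx\mid j\in J\}.$$ This is a submodule of $M$, and $\Gamma_{I,J}$, acting on homomorphisms by restriction, is an additive left exact functor on the category of $R$-modules. Let $H^i_{I,J}$ be its $i$-th right derived functor, with $H^i_{I,J}=0$ for $i<0$. For $a\in R$ let $S_{a,J}=\{a^n+j\mid n\in\mathbb N,\ j\in J\}$ (here $0\in\mathbb N$), a multiplicatively closed subset of $R$, let $R_{a,J}=S_{a,J}^{-1}R$, and let $C^\bullet_{a,J}=(0\to R\to R_{a,J}\to 0)$, with the canonical map, $R$ in degree $0$ and $R_{a,J}$ in degree $1$. For a finite sequence $\mathbf a=a_1,\dots,a_s$ of elements of $R$ let $C^\bullet_{\mathbf a,J}=\bigotimes_{i=1}^{s}C^\bullet_{a_i,J}$ be the tensor product of complexes over $R$ (for $s=0$ it is $R$ in degree $0$). **Theorem 2.4.** If $a_1,\dots,a_s$ generate the ideal $I$, then for every integer $i$ there is an isomorphism $$H^i_{I,J}(M)\cong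 H^i\bigl(C^\bullet_{\mathbf a,J}\otimes_R M\bigr)$$ of $R$-modules, natural in the $R$-module $M$. -/

import Mathlib

open CategoryTheory MonoidalCategory

universe u

namespace PairLocalCohomology

section Torsion

variable {R : Type u} [CommRing R] (I J : Ideal R)

/-- The set-theoretic condition `I ^ n x ⊆ J x`, where `J x = {j x | j ∈ J}`, says exactly that
`I ^ n` is contained in `Ann(x) + J`. -/
theorem smul_subset_iff {M : Type u} [AddCommGroup M] [Module R M] (n : ℕ) (x : M) :
    (∀ r ∈ I ^ n, ∃ j ∈ J, r • x = j • x) ↔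
      I ^ n ≤ LinearMap.ker (LinearMap.toSpanSingleton R M x) ⊔ J := by
  constructor
  · intro h r hr
    obtain ⟨j, hj, e⟩ := h r hr
    refine Submodule.mem_sup.2 ⟨r - j, ?_, j, hj, by ring⟩
    simp [sub_smul, e]
  · intro h r hr
    obtain ⟨c, hc, j, hj, e⟩ := Submodule.mem_sup.1 (h hr)
    refine ⟨j, hj, ?_⟩
    have hc' : c • x = 0 := by simpa using hc
    rw [← e, add_smul, hc', zero_add]

/-- The `(I, J)`-torsion submodule of `M`: the elements `x` such that `I ^ n x ⊆ J x`
for some natural number `n` (equivalently for all large `n`). -/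
def torsion (M : Type u) [AddCommGroup M] [Module R M] : Submodule R M where
  carrier := {x | ∃ n : ℕ, ∀ r ∈ I ^ n, ∃ j ∈ J, r • x = j • x}
  zero_mem' := ⟨0, fun _ _ => ⟨0, J.zero_mem, by simp⟩⟩
  add_mem' := by
    rintro x y ⟨n, hn⟩ ⟨m, hm⟩
    refine ⟨n + m, (smul_subset_iff I J (n + m) (x + y)).2 ?_⟩
    rw [smul_subset_iff] at hn hm
    rw [pow_add]
    refine (Ideal.mul_mono hn hm).trans (Ideal.mul_le.2 fun r hr t ht => ?_)
    obtain ⟨c, hc, j, hj, rfl⟩ := Submodule.mem_sup.1 hr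
    obtain ⟨d, hd, k, hk, rfl⟩ := Submodule.mem_sup.1 ht
    have hc' : c • x = 0 := by simpa using hc
    have hd' : d • y = 0 := by simpa using hd
    refine Submodule.mem_sup.2 ⟨c * d, ?_, c * k + j * (d + k),
      J.add_mem (J.mul_mem_left _ hk) (J.mul_mem_right _ hj), by ring⟩
    have e1 : (c * d) • x = 0 := by rw [mul_comm, mul_smul, hc', smul_zero]
    have e2 : (c * d) • y = 0 := by rw [mul_smul, hd', smul_zero]
    simp [smul_add, e1, e2]
  smul_mem' := by
    rintro c x ⟨n, hn⟩
    refine ⟨n, fun r hr => ?_⟩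
    obtain ⟨j, hj, e⟩ := hn r hr
    exact ⟨j, hj, by rw [smul_comm, e, smul_comm]⟩

theorem map_mem_torsion {M N : Type u} [AddCommGroup M] [Module R M] [AddCommGroup N] [Module R N]
    (f : M →ₗ[R] N) (x : M) (hx : x ∈ torsion I J M) : f x ∈ torsion I J N := by
  obtain ⟨n, hn⟩ := hx
  refine ⟨n, fun r hr => ?_⟩
  obtain ⟨j, hj, e⟩ := hn r hr
  exact ⟨j, hj, by rw [← map_smul, e, map_smul]⟩

/-- The `(I, J)`-torsion functor on the category of `R`-modules; on morphisms it is restriction. -/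
def torsionFunctor : ModuleCat.{u} R ⥤ ModuleCat.{u} R where
  obj M := ModuleCat.of R (torsion I J M)
  map {_ _} f := ModuleCat.ofHom (f.hom.restrict (map_mem_torsion I J f.hom))

instance : (torsionFunctor I J).Additive where

/-- The `i`-th local cohomology functor with respect to `(I, J)`: the `i`-th right derived functor
of the `(I, J)`-torsion functor, which is zero for negative `i`. -/
noncomputable def localCohomology : ℤ → (ModuleCat.{u} R ⥤ ModuleCat.{u} R)
  | .ofNat n => (torsionFunctor I J).rightDerived n
  | .negSucc _ => (Functor.const _).obj (ModuleCat.of R PUnit)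

end Torsion

section Cech

variable {R : Type u} [CommRing R] (J : Ideal R)

/-- The multiplicatively closed set `S_{a, J} = {a ^ n + j | n ∈ ℕ, j ∈ J}`. -/
def cechSubmonoid (a : R) : Submonoid R where
  carrier := {x | ∃ n : ℕ, ∃ j ∈ J, x = a ^ n + j}
  one_mem' := ⟨0, 0, J.zero_mem, by simp⟩
  mul_mem' := by
    rintro _ _ ⟨n, j, hj, rfl⟩ ⟨m, k, hk, rfl⟩
    exact ⟨n + m, a ^ n * k + j * (a ^ m + k),
      J.add_mem (J.mul_mem_left _ hk) (J.mul_mem_right _ hj), by ring⟩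

/-- The complex `0 → R → R_{a, J} → 0` with `R` in degree `0`, where `R_{a, J}` is the localization
of `R` at `S_{a, J}` and the map is the canonical one. -/
noncomputable def cechComplexOne (a : R) : CochainComplex (ModuleCat.{u} R) ℤ :=
  HomologicalComplex.double
    (ModuleCat.ofHom (Algebra.linearMap R (Localization (cechSubmonoid J a))))
    (show (ComplexShape.up ℤ).Rel 0 1 by simp)

/-- The generalized Čech complex of `a₁, …, aₛ`: the tensor product over `R` of the complexes
`0 → R → R_{aᵢ, J} → 0` (for `s = 0` it is `R` in degree `0`). -/
noncomputable def cechComplex {s : ℕ} (a : Fin s → R) : CochainComplex (ModuleCat.{u} R) ℤ :=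
  (List.ofFn a).foldr (fun x K => cechComplexOne J x ⊗ K)
    (𝟙_ (CochainComplex (ModuleCat.{u} R) ℤ))

/-- The functor `M ↦ H^i(C ⊗ M)` for a complex `C` of `R`-modules, where `M` is viewed as a complex
concentrated in degree `0`. -/
noncomputable def tensorCohomology (C : CochainComplex (ModuleCat.{u} R) ℤ) (i : ℤ) :
    ModuleCat.{u} R ⥤ ModuleCat.{u} R :=
  HomologicalComplex.single (ModuleCat.{u} R) (ComplexShape.up ℤ) 0 ⋙ tensorLeft C ⋙
    HomologicalComplex.homologyFunctor (ModuleCat.{u} R) (ComplexShape.up ℤ) i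

end Cech

end PairLocalCohomology

/-! Induct on the generators of `I`. An element `x` is torsion for `((a), J)` exactly when some
element of `S_{a,J}` kills it, so `Γ_{(a),J}(N)` is the kernel of `N → R_{a,J} ⊗ N`. Moreover
`Γ_{(a)+I',J} = Γ_{(a),J} ∩ Γ_{I',J}`. Hence `Γ_{(a)+I',J}(E)` is the kernel of `N → R_{a,J} ⊗ N`
for `N = Γ_{I',J}(E)`.

Let `E` be injective. Over a noetherian ring `N` is again injective (`baer_torsion`, by Artin-Rees),
and an injective module surjects onto its localizations (`mk_surjective_of_baer`). So for a complex
`X` of injectives, `Γ_{(a)+I',J}(X)` is quasi-isomorphic to `C_a ⊗ Γ_{I',J}(X)`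
(`quasiIso_unitDoubleLift`). As `R_{a,J}` is flat, `C_a ⊗ -` preserves quasi-isomorphisms
(`quasiIso_unitDouble_whiskerLeft`), and induction gives a natural quasi-isomorphism `Γ_{I,J}(X) → C
⊗ X` (`exists_torsion_comparison`).

For an injective resolution `M → E`, flatness also makes `C ⊗ M → C ⊗ E` a quasi-isomorphism. The
zigzag `Γ_{I,J}(E) → C ⊗ E ← C ⊗ M` is the required isomorphism on cohomology. -/

namespace PairLocalCohomology

/-! ### Torsion submodules, injective modules and localization. -/

section TorsionModules

variable {R : Type u} [CommRing R] (I I' J : Ideal R)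

theorem mem_torsion_iff {M : Type u} [AddCommGroup M] [Module R M] (x : M) :
    x ∈ torsion I J M ↔
      ∃ n : ℕ, I ^ n ≤ LinearMap.ker (LinearMap.toSpanSingleton R M x) ⊔ J :=
  exists_congr fun n => smul_subset_iff I J n x

theorem torsion_bot (M : Type u) [AddCommGroup M] [Module R M] : torsion ⊥ J M = ⊤ :=
  top_unique fun x _ => (mem_torsion_iff ⊥ J x).2 ⟨1, by simp⟩

theorem torsion_anti {I I' : Ideal R} (h : I ≤ I') (M : Type u) [AddCommGroup M] [Module R M] :
    torsion I' J M ≤ torsion I J M := fun x hx => by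
  obtain ⟨n, hn⟩ := (mem_torsion_iff I' J x).1 hx
  exact (mem_torsion_iff I J x).2 ⟨n, (Ideal.pow_right_mono h n).trans hn⟩

theorem torsion_sup (M : Type u) [AddCommGroup M] [Module R M] :
    torsion (I ⊔ I') J M = torsion I J M ⊓ torsion I' J M := by
  refine le_antisymm (le_inf (torsion_anti J le_sup_left M) (torsion_anti J le_sup_right M)) ?_
  rintro x ⟨h, h'⟩
  obtain ⟨n, hn⟩ := (mem_torsion_iff I J x).1 h
  obtain ⟨m, hm⟩ := (mem_torsion_iff I' J x).1 h'
  exact (mem_torsion_iff _ J x).2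
    ⟨n + m, Ideal.sup_pow_add_le_pow_sup_pow.trans (sup_le hn hm)⟩

/-- For a principal ideal only the generator `a ^ n` of the power matters, and `a ^ n = c + j` with
`c` killing `x` means that `a ^ n - j` kills `x`. This is what links torsion to `R_{a,J}`. -/
theorem mem_torsion_span_singleton_iff (a : R) {M : Type u} [AddCommGroup M] [Module R M] (x : M) :
    x ∈ torsion (Ideal.span {a}) J M ↔ ∃ s ∈ cechSubmonoid J a, s • x = 0 := by
  rw [mem_torsion_iff]
  constructor
  · rintro ⟨n, hn⟩
    obtain ⟨c, hc, j, hj, e⟩ := Submodule.mem_sup.1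
      (hn (Ideal.pow_mem_pow (Ideal.mem_span_singleton_self a) n))
    refine ⟨c, ⟨n, -j, J.neg_mem hj, by rw [← e]; ring⟩, by simpa using hc⟩
  · rintro ⟨_, ⟨n, j, hj, rfl⟩, h⟩
    refine ⟨n, ?_⟩
    rw [Ideal.span_singleton_pow, Ideal.span_singleton_le_iff_mem]
    exact Submodule.mem_sup.2 ⟨a ^ n + j, by simpa using h, -j, J.neg_mem hj, by ring⟩

/-- Serves to add generators to a finitely generated torsion module: the annihilator of a sum is the
intersection of the annihilators. -/
theorem sup_mul_sup_le_inf_sup (A B : Ideal R) : (A ⊔ J) * (B ⊔ J) ≤ A ⊓ B ⊔ J := by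
  refine Ideal.mul_le.2 fun r hr t ht => ?_
  obtain ⟨c, hc, j, hj, rfl⟩ := Submodule.mem_sup.1 hr
  obtain ⟨d, hd, k, hk, rfl⟩ := Submodule.mem_sup.1 ht
  exact Submodule.mem_sup.2 ⟨c * d, ⟨A.mul_mem_right _ hc, B.mul_mem_left _ hd⟩,
    c * k + j * (d + k), J.add_mem (J.mul_mem_left _ hk) (J.mul_mem_right _ hj), by ring⟩

/-- A finitely generated `(I, J)`-torsion module is uniformly `(I, J)`-torsion. -/
theorem exists_pow_le_annihilator_sup {M : Type u} [AddCommGroup M] [Module R M]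
    (N : Submodule R M) (hN : N.FG) (h : N ≤ torsion I J M) :
    ∃ n : ℕ, I ^ n ≤ N.annihilator ⊔ J := by
  induction N, hN using Submodule.fg_induction with
  | singleton x =>
    obtain ⟨n, hn⟩ := (mem_torsion_iff I J x).1 (h (Submodule.mem_span_singleton_self x))
    refine ⟨n, hn.trans (sup_le_sup_right (fun r hr => ?_) J)⟩
    rw [Submodule.mem_annihilator_span_singleton]
    simpa using hr
  | sup N₁ N₂ _ _ h₁ h₂ =>
    obtain ⟨n, hn⟩ := h₁ (le_sup_left.trans h)
    obtain ⟨m, hm⟩ := h₂ (le_sup_right.trans h)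
    refine ⟨n + m, ?_⟩
    rw [pow_add, Submodule.annihilator_sup]
    exact (Ideal.mul_mono hn hm).trans (sup_mul_sup_le_inf_sup J _ _)

/-- Over a noetherian ring, the `(I, J)`-torsion submodule of an injective module is injective. -/
theorem baer_torsion [IsNoetherianRing R] {M : Type u} [AddCommGroup M] [Module R M]
    (hM : Module.Baer R M) : Module.Baer R (torsion I J M) := by
  intro 𝔟 f
  set F : 𝔟 →ₗ[R] M := (torsion I J M).subtype ∘ₗ f
  obtain ⟨n, hn⟩ := exists_pow_le_annihilator_sup I J (LinearMap.range F)
    (LinearMap.range_eq_map F ▸ (IsNoetherian.noetherian (⊤ : Submodule R 𝔟)).map F)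
    (by rintro _ ⟨y, rfl⟩; exact (f y).2)
  set 𝔠 := (LinearMap.range F).annihilator
  have hc : ∀ c ∈ 𝔠, ∀ y, c • F y = 0 := fun c hc y =>
    Submodule.mem_annihilator.1 hc _ ⟨y, rfl⟩
  obtain ⟨k, hk⟩ := Ideal.exists_pow_inf_eq_pow_smul 𝔠 (M := R) 𝔟
  -- Artin-Rees puts `𝔠 ^ (k + 1) ⊓ 𝔟` inside `𝔠 𝔟`, on which `F` vanishes because `𝔠` annihilates
  -- its range.
  have hle : 𝔠 ^ (k + 1) ⊓ 𝔟 ≤ (LinearMap.ker F).map 𝔟.subtype := by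
    have := hk (k + 1) (by omega)
    rw [Nat.add_sub_cancel_left, pow_one, smul_eq_mul, Ideal.mul_top] at this
    rw [this]
    refine Submodule.smul_le.2 fun c hc' b hb => ?_
    exact ⟨c • ⟨b, hb.2⟩, by rw [SetLike.mem_coe, LinearMap.mem_ker, map_smul, hc c hc'], rfl⟩
  have hF : ∀ (x : 𝔟), (x : R) ∈ 𝔠 ^ (k + 1) → F x = 0 := fun x hx => by
    obtain ⟨y, hy, e⟩ := hle ⟨hx, x.2⟩
    obtain rfl : y = x := Subtype.ext e
    exact hy
  have hpq : ∀ (x : (LinearPMap.mk 𝔟 F).domain)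
      (y : (LinearPMap.mk (𝔠 ^ (k + 1)) (0 : _ →ₗ[R] M)).domain), (x : R) = y →
      LinearPMap.mk 𝔟 F x = LinearPMap.mk (𝔠 ^ (k + 1)) (0 : _ →ₗ[R] M) y :=
    fun x y hxy => hF x (by rw [hxy]; exact y.2)
  -- Gluing `F` with zero on `𝔠 ^ (k + 1)` before extending to `R` forces `𝔠 ^ (k + 1)` to kill `g
  -- 1`; an arbitrary extension of `F` need not have torsion values.
  obtain ⟨g, hg⟩ := hM _ ((LinearPMap.mk 𝔟 F).sup (LinearPMap.mk (𝔠 ^ (k + 1)) 0) hpq).toFun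
  have hgb : ∀ x : 𝔟, g x = F x := fun x => by
    rw [hg x (show (x : R) ∈ 𝔟 ⊔ 𝔠 ^ (k + 1) from Submodule.mem_sup_left x.2)]
    exact ((LinearPMap.left_le_sup (LinearPMap.mk 𝔟 F) (LinearPMap.mk (𝔠 ^ (k + 1)) 0) hpq).2
      (x := x) (y := ⟨x, Submodule.mem_sup_left x.2⟩) rfl).symm
  have hgc : ∀ x ∈ 𝔠 ^ (k + 1), g x = 0 := fun x hx => by
    rw [hg x (show x ∈ 𝔟 ⊔ 𝔠 ^ (k + 1) from Submodule.mem_sup_right hx)]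
    exact ((LinearPMap.right_le_sup (LinearPMap.mk 𝔟 F) (LinearPMap.mk (𝔠 ^ (k + 1)) 0) hpq).2
      (x := ⟨x, hx⟩) (y := ⟨x, Submodule.mem_sup_right hx⟩) rfl).symm
  have h1 : g 1 ∈ torsion I J M := by
    -- The exponent comes from `(𝔠 + J) ^ ((k + 1) + 1) ≤ 𝔠 ^ (k + 1) + J`, applied after `I ^ n ≤ 𝔠
    -- + J`.
    refine (mem_torsion_iff I J _).2 ⟨n * (k + 1 + 1), ?_⟩
    rw [pow_mul]
    refine (Ideal.pow_right_mono hn _).trans (Ideal.sup_pow_add_le_pow_sup_pow.trans ?_)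
    rw [pow_one]
    refine sup_le_sup_right (fun x hx => ?_) J
    simpa [← map_smul] using hgc x hx
  refine ⟨LinearMap.toSpanSingleton R _ ⟨g 1, h1⟩, fun x hx => Subtype.ext ?_⟩
  simpa [← map_smul, F] using hgb ⟨x, hx⟩

/-- Over a noetherian ring, an injective module surjects onto each of its localizations. -/
theorem mk_surjective_of_baer [IsNoetherianRing R] (S : Submonoid R) {M : Type u} [AddCommGroup M]
    [Module R M] (hM : Module.Baer R M) :
    Function.Surjective (TensorProduct.mk R (Localization S) M 1) := by
  intro z
  obtain ⟨⟨m, s⟩, rfl⟩ := IsLocalizedModule.mk'_surjective S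
    (TensorProduct.mk R (Localization S) M 1) z
  obtain ⟨k, hk⟩ := monotone_stabilizes_iff_noetherian.2 ‹IsNoetherianRing R›
    { toFun := fun n => LinearMap.ker (LinearMap.mulLeft R ((s : R) ^ n))
      monotone' := monotone_nat_of_le_succ fun n r hr => by
        simp only [LinearMap.mem_ker, LinearMap.mulLeft_apply] at hr ⊢
        rw [pow_succ', mul_assoc, hr, mul_zero] }
  have hk' : ∀ r : R, (s : R) ^ (k + 1) * r = 0 → (s : R) ^ k * r = 0 := fun r hr => by
    have : r ∈ LinearMap.ker (LinearMap.mulLeft R ((s : R) ^ (k + 1))) := by simpa using hr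
    have e := hk (k + 1) (by omega)
    simp only [OrderHom.coe_mk] at e
    rw [← e] at this
    simpa using this
  set φ := LinearMap.mulLeft R ((s : R) ^ (k + 1))
  have hker : LinearMap.ker φ ≤
      LinearMap.ker (LinearMap.toSpanSingleton R M ((s : R) ^ k • m)) := fun r hr => by
    have := hk' r (by simpa [φ] using hr)
    simp [smul_smul, mul_comm r, this]
  -- The annihilators of the powers of `s` are stable from `k` on, so `s ^ (k + 1) r ↦ r s ^ k m` is
  -- well defined on the ideal generated by `s ^ (k + 1)`. Extended to `R`, it gives `g 1` with `s ^
  -- (k + 1) g 1 = s ^ k m`, so `g 1` maps to `m / s`.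
  obtain ⟨g, hg⟩ := hM (LinearMap.range φ)
    ((LinearMap.ker φ).liftQ _ hker ∘ₗ φ.quotKerEquivRange.symm.toLinearMap)
  have key : (s : R) ^ (k + 1) • g 1 = (s : R) ^ k • m := by
    have h := hg (φ 1) ⟨1, rfl⟩
    have e : φ.quotKerEquivRange.symm ⟨φ 1, ⟨1, rfl⟩⟩ = Submodule.Quotient.mk 1 := by
      rw [LinearEquiv.symm_apply_eq]; rfl
    rw [LinearMap.comp_apply, LinearEquiv.coe_coe, e, Submodule.liftQ_apply] at h
    simpa [φ, ← map_smul] using h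
  refine ⟨g 1, ?_⟩
  symm
  rw [Function.uncurry_apply_pair, IsLocalizedModule.mk'_eq_iff]
  refine IsLocalizedModule.smul_injective (S := S) (TensorProduct.mk R (Localization S) M 1)
    (s ^ k) ?_
  simp only [Submonoid.smul_def, ← LinearMap.map_smul (TensorProduct.mk R (Localization S) M 1),
    SubmonoidClass.coe_pow, smul_smul]
  rw [← pow_succ, key]

theorem mk_eq_zero_iff (a : R) {M : Type u} [AddCommGroup M] [Module R M] (x : M) :
    TensorProduct.mk R (Localization (cechSubmonoid J a)) M 1 x = 0 ↔
      x ∈ torsion (Ideal.span {a}) J M := by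
  rw [mem_torsion_span_singleton_iff, IsLocalizedModule.eq_zero_iff (cechSubmonoid J a)]
  simp [Submonoid.smul_def]

end TorsionModules

/-! ### Quasi-isomorphisms in terms of cocycles and coboundaries. -/

section QuasiIso

variable {R : Type u} [CommRing R]

theorem homologyπ_eq_zero_iff (K : CochainComplex (ModuleCat.{u} R) ℤ) (n m : ℤ) (h : n + 1 = m)
    (z : K.cycles m) : K.homologyπ m z = 0 ↔ ∃ x, K.d n m x = K.iCycles m z := by
  have hp : (ComplexShape.up ℤ).prev m = n := by simp [← h]
  have hex : (ShortComplex.mk (K.toCycles n m) (K.homologyπ m) (by simp)).Exact :=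
    ShortComplex.exact_of_g_is_cokernel _ (K.homologyIsCokernel n m hp)
  rw [ShortComplex.moduleCat_exact_iff] at hex
  have hinj : Function.Injective (K.iCycles m) := (ModuleCat.mono_iff_injective _).1 inferInstance
  constructor
  · intro hz
    obtain ⟨x, rfl⟩ := hex z hz
    exact ⟨x, by rw [← ConcreteCategory.comp_apply, K.toCycles_i]⟩
  · rintro ⟨x, hx⟩
    obtain rfl : K.toCycles n m x = z :=
      hinj (by rw [← hx, ← ConcreteCategory.comp_apply, K.toCycles_i])
    rw [← ConcreteCategory.comp_apply, K.toCycles_comp_homologyπ]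
    rfl

theorem exists_cycles (K : CochainComplex (ModuleCat.{u} R) ℤ) (n m : ℤ) (h : n + 1 = m)
    (x : K.X n) (hx : K.d n m x = 0) : ∃ z : K.cycles n, K.iCycles n z = x := by
  have hex : (ShortComplex.mk (K.iCycles n) (K.d n m) (by simp)).Exact :=
    ShortComplex.exact_of_f_is_kernel _ (K.cyclesIsKernel n m (by simp [← h]))
  exact (ShortComplex.moduleCat_exact_iff _).1 hex x hx

theorem d_iCycles_apply (K : CochainComplex (ModuleCat.{u} R) ℤ) (n m : ℤ) (z : K.cycles n) :
    K.d n m (K.iCycles n z) = 0 := by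
  rw [← ConcreteCategory.comp_apply, K.iCycles_d]
  rfl

/-- A morphism of complexes of modules is injective and surjective in cohomology if and only if
it is so in terms of cocycles and coboundaries. -/
theorem quasiIso_iff_cocycles {K L : CochainComplex (ModuleCat.{u} R) ℤ} (f : K ⟶ L) :
    QuasiIso f ↔
      (∀ (n m : ℤ), n + 1 = m → ∀ (x : K.X m) (y : L.X n), K.d m (m + 1) x = 0 →
        f.f m x = L.d n m y → ∃ w : K.X n, K.d n m w = x) ∧
      (∀ (n m : ℤ), n + 1 = m → ∀ y : L.X m, L.d m (m + 1) y = 0 →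
        ∃ (x : K.X m) (w : L.X n), K.d m (m + 1) x = 0 ∧ f.f m x + L.d n m w = y) := by
  have hinj : ∀ m, Function.Injective (L.iCycles m) :=
    fun m => (ModuleCat.mono_iff_injective _).1 inferInstance
  have hπK : ∀ m, Function.Surjective (K.homologyπ m) :=
    fun m => (ModuleCat.epi_iff_surjective _).1 inferInstance
  have hπL : ∀ m, Function.Surjective (L.homologyπ m) :=
    fun m => (ModuleCat.epi_iff_surjective _).1 inferInstance
  have hmap : ∀ m (z : K.cycles m), HomologicalComplex.homologyMap f m (K.homologyπ m z) =
      L.homologyπ m (HomologicalComplex.cyclesMap f m z) := fun m z => by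
    rw [← ConcreteCategory.comp_apply, HomologicalComplex.homologyπ_naturality,
      ConcreteCategory.comp_apply]
  have hi : ∀ m (z : K.cycles m), L.iCycles m (HomologicalComplex.cyclesMap f m z) =
      f.f m (K.iCycles m z) := fun m z => by
    rw [← ConcreteCategory.comp_apply, HomologicalComplex.cyclesMap_i,
      ConcreteCategory.comp_apply]
  have hiso : QuasiIso f ↔
      ∀ m, Function.Bijective (HomologicalComplex.homologyMap f m) := by
    rw [quasiIso_iff]
    refine forall_congr' fun m => ?_
    rw [quasiIsoAt_iff_isIso_homologyMap, ConcreteCategory.isIso_iff_bijective]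
  rw [hiso]
  constructor
  · refine fun h => ⟨fun n m hnm x y hx hy => ?_, fun n m hnm y hy => ?_⟩
    · obtain ⟨z, rfl⟩ := exists_cycles K m (m + 1) rfl x hx
      refine (homologyπ_eq_zero_iff K n m hnm z).1 ((h m).1 ?_)
      rw [hmap, map_zero, homologyπ_eq_zero_iff L n m hnm]
      exact ⟨y, by rw [hi, hy]⟩
    · obtain ⟨z, rfl⟩ := exists_cycles L m (m + 1) rfl y hy
      obtain ⟨t, ht⟩ := (h m).2 (L.homologyπ m z)
      obtain ⟨c, rfl⟩ := hπK m t
      have : L.homologyπ m (z - HomologicalComplex.cyclesMap f m c) = 0 := by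
        rw [map_sub, ← hmap, ht, sub_self]
      obtain ⟨w, hw⟩ := (homologyπ_eq_zero_iff L n m hnm _).1 this
      exact ⟨K.iCycles m c, w, d_iCycles_apply _ _ _ _, by rw [hw, map_sub, hi]; abel⟩
  · rintro ⟨h₁, h₂⟩ m
    constructor
    · rw [injective_iff_map_eq_zero]
      intro t ht
      obtain ⟨z, rfl⟩ := hπK m t
      rw [hmap, homologyπ_eq_zero_iff L (m - 1) m (by omega)] at ht
      obtain ⟨y, hy⟩ := ht
      rw [homologyπ_eq_zero_iff K (m - 1) m (by omega)]
      exact h₁ (m - 1) m (by omega) _ y (d_iCycles_apply _ _ _ _) (by rw [hy, hi])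
    · intro t
      obtain ⟨z, rfl⟩ := hπL m t
      obtain ⟨x, w, hx, hw⟩ := h₂ (m - 1) m (by omega) _ (d_iCycles_apply L m (m + 1) z)
      obtain ⟨c, rfl⟩ := exists_cycles K m (m + 1) rfl x hx
      refine ⟨K.homologyπ m c, ?_⟩
      rw [hmap, ← sub_eq_zero, ← neg_eq_zero, neg_sub, ← map_sub,
        homologyπ_eq_zero_iff L (m - 1) m (by omega)]
      exact ⟨w, by rw [map_sub, hi, ← hw]; abel⟩

end QuasiIso

/-! ### The tensor product of a two-term complex with a complex, split degreewise. -/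

section TensorDouble

open HomologicalComplex

variable {R : Type u} [CommRing R] {B : ModuleCat.{u} R} (f : 𝟙_ (ModuleCat.{u} R) ⟶ B)

/-- The complex `0 → R → B → 0` with `R` in degree `0`. -/
noncomputable abbrev unitDouble : CochainComplex (ModuleCat.{u} R) ℤ :=
  HomologicalComplex.double f (show (ComplexShape.up ℤ).Rel 0 1 by simp)

/-- The canonical map `X ⟶ B ⊗ X` given by `f : R ⟶ B`. -/
noncomputable def unitMap (X : ModuleCat.{u} R) : X ⟶ B ⊗ X := (λ_ X).inv ≫ (f ▷ X)

/-- The inclusion of the degree zero part `R ⊗ X = X`. -/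
noncomputable def unitDoubleInl (X : CochainComplex (ModuleCat.{u} R) ℤ) (n : ℤ) :
    X.X n ⟶ (unitDouble f ⊗ X).X n :=
  (λ_ (X.X n)).inv ≫ ((doubleXIso₀ f _).inv ▷ X.X n) ≫
    ιTensorObj (unitDouble f) X 0 n n (zero_add n)

/-- The inclusion of the degree one part `B ⊗ X`. -/
noncomputable def unitDoubleInr (X : CochainComplex (ModuleCat.{u} R) ℤ) (n m : ℤ)
    (h : 1 + n = m) : B ⊗ X.X n ⟶ (unitDouble f ⊗ X).X m :=
  ((doubleXIso₁ f _ zero_ne_one).inv ▷ X.X n) ≫ ιTensorObj (unitDouble f) X 1 n m h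

/-- The two-term complex vanishes outside degrees 0 and 1, so only two summands of the tensor
product are nonzero. -/
theorem unitDouble_hom_ext {X : CochainComplex (ModuleCat.{u} R) ℤ} {n m : ℤ} (h : 1 + n = m)
    {Y : ModuleCat.{u} R} {α β : (unitDouble f ⊗ X).X m ⟶ Y}
    (hl : unitDoubleInl f X m ≫ α = unitDoubleInl f X m ≫ β)
    (hr : unitDoubleInr f X n m h ≫ α = unitDoubleInr f X n m h ≫ β) : α = β := by
  refine mapBifunctor.hom_ext fun i j hij => ?_
  change i + j = m at hij
  by_cases hi : i = 0
  · subst hi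
    obtain rfl : j = m := by omega
    rw [← cancel_epi ((doubleXIso₀ f (show (ComplexShape.up ℤ).Rel 0 1 by simp)).inv ▷ X.X j)]
    simpa [unitDoubleInl] using hl
  by_cases hi' : i = 1
  · subst hi'
    obtain rfl : j = n := by omega
    rw [← cancel_epi ((doubleXIso₁ f (show (ComplexShape.up ℤ).Rel 0 1 by simp)
      zero_ne_one).inv ▷ X.X j)]
    simpa [unitDoubleInr] using hr
  · have hz : Limits.IsZero ((unitDouble f).X i ⊗ X.X j) :=
      (tensorRight (X.X j)).map_isZero (isZero_double_X f _ i hi hi')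
    exact hz.eq_of_src _ _

/-- The projection onto the degree zero part `R ⊗ X = X`. -/
noncomputable def unitDoubleFst (X : CochainComplex (ModuleCat.{u} R) ℤ) (m : ℤ) :
    (unitDouble f ⊗ X).X m ⟶ X.X m :=
  mapBifunctorDesc (fun i j (hij : i + j = m) =>
    if hi : i = 0 then
      (((unitDouble f).XIsoOfEq hi).hom ⊗ₘ (X.XIsoOfEq (by omega : j = m)).hom) ≫
        ((doubleXIso₀ f _).hom ▷ X.X m) ≫ (λ_ (X.X m)).hom
    else 0)

/-- The projection onto the degree one part `B ⊗ X`. -/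
noncomputable def unitDoubleSnd (X : CochainComplex (ModuleCat.{u} R) ℤ) (n m : ℤ)
    (h : 1 + n = m) : (unitDouble f ⊗ X).X m ⟶ B ⊗ X.X n :=
  mapBifunctorDesc (fun i j (hij : i + j = m) =>
    if hi : i = 1 then
      (((unitDouble f).XIsoOfEq hi).hom ⊗ₘ (X.XIsoOfEq (by omega : j = n)).hom) ≫
        ((doubleXIso₁ f _ zero_ne_one).hom ▷ X.X n)
    else 0)

variable (X : CochainComplex (ModuleCat.{u} R) ℤ)

theorem unitDoubleInl_fst (m : ℤ) : unitDoubleInl f X m ≫ unitDoubleFst f X m = 𝟙 _ := by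
  simp [unitDoubleInl, unitDoubleFst]

theorem unitDoubleInr_fst (n m : ℤ) (h : 1 + n = m) :
    unitDoubleInr f X n m h ≫ unitDoubleFst f X m = 0 := by
  simp [unitDoubleInr, unitDoubleFst]

theorem unitDoubleInl_snd (n m : ℤ) (h : 1 + n = m) :
    unitDoubleInl f X m ≫ unitDoubleSnd f X n m h = 0 := by
  simp [unitDoubleInl, unitDoubleSnd]

theorem unitDoubleInr_snd (n m : ℤ) (h : 1 + n = m) :
    unitDoubleInr f X n m h ≫ unitDoubleSnd f X n m h = 𝟙 _ := by
  simp [unitDoubleInr, unitDoubleSnd]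

theorem unitDouble_id (n m : ℤ) (h : 1 + n = m) :
    unitDoubleFst f X m ≫ unitDoubleInl f X m +
      unitDoubleSnd f X n m h ≫ unitDoubleInr f X n m h = 𝟙 _ := by
  refine unitDouble_hom_ext f h ?_ ?_
  · simp [reassoc_of% unitDoubleInl_fst, reassoc_of% unitDoubleInl_snd]
  · simp [reassoc_of% unitDoubleInr_fst, reassoc_of% unitDoubleInr_snd]

theorem unitDoubleInl_d (n m : ℤ) (h : 1 + n = m) :
    unitDoubleInl f X n ≫ (unitDouble f ⊗ X).d n m =
      X.d n m ≫ unitDoubleInl f X m + unitMap f (X.X n) ≫ unitDoubleInr f X n m h := by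
  have h01 : (ComplexShape.up ℤ).Rel 0 1 := by simp
  have hnm : (ComplexShape.up ℤ).Rel n m := by simp [← h, add_comm]
  change _ ≫ (mapBifunctor (unitDouble f) X (curriedTensor (ModuleCat R)) (.up ℤ)).d n m = _
  rw [mapBifunctor.d_eq]
  simp only [unitDoubleInl, Category.assoc, Preadditive.comp_add, mapBifunctor.ι_D₁,
    mapBifunctor.ι_D₂]
  rw [mapBifunctor.d₁_eq _ _ _ _ h01 _ _ h, mapBifunctor.d₂_eq _ _ _ _ _ hnm _ (zero_add m),
    add_comm]
  congr 1
  · simp [← whisker_exchange_assoc]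
  · simp [double_d f _ zero_ne_one, unitMap, unitDoubleInr]

/-- The minus sign is the Koszul sign for moving the differential past degree 1. -/
theorem unitDoubleInr_d (n m k : ℤ) (h : 1 + n = m) (h' : 1 + m = k) :
    unitDoubleInr f X n m h ≫ (unitDouble f ⊗ X).d m k =
      -((B ◁ X.d n m) ≫ unitDoubleInr f X m k h') := by
  have h12 : (ComplexShape.up ℤ).Rel 1 2 := by simp
  have hnm : (ComplexShape.up ℤ).Rel n m := by simp [← h, add_comm]
  change _ ≫ (mapBifunctor (unitDouble f) X (curriedTensor (ModuleCat R)) (.up ℤ)).d m k = _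
  rw [mapBifunctor.d_eq]
  simp only [unitDoubleInr, Category.assoc, Preadditive.comp_add, mapBifunctor.ι_D₁,
    mapBifunctor.ι_D₂]
  rw [mapBifunctor.d₁_eq' _ _ _ _ h12, mapBifunctor.d₂_eq _ _ _ _ _ hnm _ h',
    double_d_eq_zero₀ _ _ _ _ one_ne_zero]
  simp [whisker_exchange_assoc]

variable {X} {Y : CochainComplex (ModuleCat.{u} R) ℤ} (φ : X ⟶ Y)

theorem unitDoubleInl_whiskerLeft (n : ℤ) :
    unitDoubleInl f X n ≫ (unitDouble f ◁ φ).f n = φ.f n ≫ unitDoubleInl f Y n := by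
  change _ ≫ (mapBifunctorMap (𝟙 (unitDouble f)) φ _ _).f n = _
  simp [unitDoubleInl, ← whisker_exchange_assoc]

theorem unitDoubleInr_whiskerLeft (n m : ℤ) (h : 1 + n = m) :
    unitDoubleInr f X n m h ≫ (unitDouble f ◁ φ).f m =
      (B ◁ φ.f n) ≫ unitDoubleInr f Y n m h := by
  change _ ≫ (mapBifunctorMap (𝟙 (unitDouble f)) φ _ _).f m = _
  simp [unitDoubleInr, whisker_exchange_assoc]

end TensorDouble

/-! ### The tensor product as a shifted mapping cone of `X → B ⊗ X`. -/

section Cone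

variable {R : Type u} [CommRing R] {B : ModuleCat.{u} R} (f : 𝟙_ (ModuleCat.{u} R) ⟶ B)

theorem unitMap_naturality {M N : ModuleCat.{u} R} (g : M ⟶ N) :
    unitMap f M ≫ (B ◁ g) = g ≫ unitMap f N := by
  simp [unitMap, ← whisker_exchange]

variable (X : CochainComplex (ModuleCat.{u} R) ℤ)

theorem exists_unitDoubleInl_add_inr {n m : ℤ} (h : 1 + n = m) (t : (unitDouble f ⊗ X).X m) :
    ∃ (x : X.X m) (y : (B ⊗ X.X n : ModuleCat R)),
      unitDoubleInl f X m x + unitDoubleInr f X n m h y = t :=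
  ⟨unitDoubleFst f X m t, unitDoubleSnd f X n m h t,
    congr($(unitDouble_id f X n m h).hom t)⟩

theorem unitDoubleInl_add_inr_inj {n m : ℤ} (h : 1 + n = m) {x x' : X.X m}
    {y y' : (B ⊗ X.X n : ModuleCat R)}
    (e : unitDoubleInl f X m x + unitDoubleInr f X n m h y =
      unitDoubleInl f X m x' + unitDoubleInr f X n m h y') : x = x' ∧ y = y' := by
  have h₁ : ∀ x, unitDoubleFst f X m (unitDoubleInl f X m x) = x :=
    fun x => congr($(unitDoubleInl_fst f X m).hom x)
  have h₂ : ∀ y, unitDoubleFst f X m (unitDoubleInr f X n m h y) = 0 :=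
    fun y => congr($(unitDoubleInr_fst f X n m h).hom y)
  have h₃ : ∀ x, unitDoubleSnd f X n m h (unitDoubleInl f X m x) = 0 :=
    fun x => congr($(unitDoubleInl_snd f X n m h).hom x)
  have h₄ : ∀ y, unitDoubleSnd f X n m h (unitDoubleInr f X n m h y) = y :=
    fun y => congr($(unitDoubleInr_snd f X n m h).hom y)
  constructor
  · simpa [h₁, h₂] using congr(unitDoubleFst f X m $e)
  · simpa [h₃, h₄] using congr(unitDoubleSnd f X n m h $e)

theorem unitDouble_d_apply {n m k : ℤ} (h : 1 + n = m) (h' : 1 + m = k) (x : X.X m)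
    (y : (B ⊗ X.X n : ModuleCat R)) :
    (unitDouble f ⊗ X).d m k (unitDoubleInl f X m x + unitDoubleInr f X n m h y) =
      unitDoubleInl f X k (X.d m k x) +
        unitDoubleInr f X m k h' (unitMap f (X.X m) x - (B ◁ X.d n m) y) := by
  have h₁ : (unitDouble f ⊗ X).d m k (unitDoubleInl f X m x) =
      unitDoubleInl f X k (X.d m k x) + unitDoubleInr f X m k h' (unitMap f (X.X m) x) :=
    congr($(unitDoubleInl_d f X m k h').hom x)
  have h₂ : (unitDouble f ⊗ X).d m k (unitDoubleInr f X n m h y) =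
      -unitDoubleInr f X m k h' ((B ◁ X.d n m) y) :=
    congr($(unitDoubleInr_d f X n m k h h').hom y)
  rw [map_add, h₁, h₂, map_sub]
  abel

variable {X} {Y : CochainComplex (ModuleCat.{u} R) ℤ}

theorem unitDouble_whiskerLeft_apply (φ : X ⟶ Y) {n m : ℤ} (h : 1 + n = m) (x : X.X m)
    (y : (B ⊗ X.X n : ModuleCat R)) :
    (unitDouble f ◁ φ).f m (unitDoubleInl f X m x + unitDoubleInr f X n m h y) =
      unitDoubleInl f Y m (φ.f m x) + unitDoubleInr f Y n m h ((B ◁ φ.f n) y) := by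
  have h₁ : (unitDouble f ◁ φ).f m (unitDoubleInl f X m x) = unitDoubleInl f Y m (φ.f m x) :=
    congr($(unitDoubleInl_whiskerLeft f φ m).hom x)
  have h₂ : (unitDouble f ◁ φ).f m (unitDoubleInr f X n m h y) =
      unitDoubleInr f Y n m h ((B ◁ φ.f n) y) :=
    congr($(unitDoubleInr_whiskerLeft f φ n m h).hom y)
  rw [map_add, h₁, h₂]

/-- If `B` is flat, tensoring with `0 → R → B → 0` preserves quasi-isomorphisms. -/
theorem quasiIso_unitDouble_whiskerLeft [Module.Flat R B] (φ : X ⟶ Y) (hφ : QuasiIso φ) :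
    QuasiIso (unitDouble f ◁ φ) := by
  -- Flatness enters here: `B ⊗ -` is exact, hence preserves quasi-isomorphisms. The rest is the
  -- five lemma for the two cones, done on elements.
  have hB : QuasiIso (((tensorLeft B).mapHomologicalComplex (.up ℤ)).map φ) := inferInstance
  obtain ⟨i, s⟩ := (quasiIso_iff_cocycles φ).1 hφ
  have iB : ∀ n m, n + 1 = m → ∀ (x : (B ⊗ X.X m : ModuleCat R)) (y : (B ⊗ Y.X n : ModuleCat R)),
      (B ◁ X.d m (m + 1)) x = 0 → (B ◁ φ.f m) x = (B ◁ Y.d n m) y →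
        ∃ w : (B ⊗ X.X n : ModuleCat R), (B ◁ X.d n m) w = x :=
    ((quasiIso_iff_cocycles _).1 hB).1
  have sB : ∀ n m, n + 1 = m → ∀ (y : (B ⊗ Y.X m : ModuleCat R)), (B ◁ Y.d m (m + 1)) y = 0 →
      ∃ (x : (B ⊗ X.X m : ModuleCat R)) (w : (B ⊗ Y.X n : ModuleCat R)),
        (B ◁ X.d m (m + 1)) x = 0 ∧ (B ◁ φ.f m) x + (B ◁ Y.d n m) w = y :=
    ((quasiIso_iff_cocycles _).1 hB).2
  have hu : ∀ n (x : X.X n), (B ◁ φ.f n) (unitMap f _ x) = unitMap f _ (φ.f n x) :=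
    fun n x => congr($(unitMap_naturality f (φ.f n)).hom x)
  have hdX : ∀ n m (x : X.X n), (B ◁ X.d n m) (unitMap f _ x) = unitMap f _ (X.d n m x) :=
    fun n m x => congr($(unitMap_naturality f (X.d n m)).hom x)
  have hdY : ∀ n m (x : Y.X n), (B ◁ Y.d n m) (unitMap f _ x) = unitMap f _ (Y.d n m x) :=
    fun n m x => congr($(unitMap_naturality f (Y.d n m)).hom x)
  have hc : ∀ n m (x : X.X n), Y.d n m (φ.f n x) = φ.f m (X.d n m x) :=
    fun n m x => congr($(φ.comm n m).hom x)
  have hcB : ∀ n m (x : (B ⊗ X.X n : ModuleCat R)),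
      (B ◁ Y.d n m) ((B ◁ φ.f n) x) = (B ◁ φ.f m) ((B ◁ X.d n m) x) :=
    fun n m x => congr($((((tensorLeft B).mapHomologicalComplex (.up ℤ)).map φ).comm n m).hom x)
  refine (quasiIso_iff_cocycles _).2 ⟨fun n m hnm t v ht hv => ?_, fun n m hnm t ht => ?_⟩
  · have hnm' : 1 + n = m := by omega
    obtain ⟨k, hk⟩ : ∃ k, 1 + k = n := ⟨n - 1, by omega⟩
    obtain ⟨x, y, rfl⟩ := exists_unitDoubleInl_add_inr f X hnm' t
    obtain ⟨a, b, rfl⟩ := exists_unitDoubleInl_add_inr f Y hk v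
    rw [unitDouble_d_apply f X hnm' (add_comm 1 m)] at ht
    obtain ⟨hx, hy⟩ := unitDoubleInl_add_inr_inj f X (add_comm 1 m) (x' := 0) (y' := 0)
      (ht.trans (by simp))
    rw [unitDouble_d_apply f Y hk hnm', unitDouble_whiskerLeft_apply f φ hnm'] at hv
    obtain ⟨hv₁, hv₂⟩ := unitDoubleInl_add_inr_inj f Y hnm' hv
    obtain ⟨w, rfl⟩ := i n m hnm x a hx hv₁
    -- The primitive `w` of `x` need not match `a`. Subtracting a cocycle `x₀` makes `φ (w - x₀)`
    -- and `a` differ by a coboundary, so that the second coordinate can be corrected through `iB`.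
    obtain ⟨x₀, w₀, hx₀, hw₀⟩ := s k n (by omega) (φ.f n w - a) (by
      obtain rfl := hnm
      rw [map_sub, hc, hv₁, sub_self])
    obtain rfl := hnm
    obtain ⟨c, hc'⟩ := iB k n (by omega) (y - unitMap f _ (w - x₀)) (-b - unitMap f _ w₀)
      (by
        rw [map_sub, hdX, map_sub, hx₀, sub_zero, ← sub_eq_zero.1 hy, sub_self])
      (by
        have hU := congr(unitMap f _ $hw₀)
        simp only [map_add, map_sub] at hU
        simp only [map_sub, map_neg, hu, hv₂, hdY]
        rw [← sub_eq_zero, ← sub_eq_zero.2 hU]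
        abel)
    refine ⟨unitDoubleInl f X n (w - x₀) + unitDoubleInr f X k n hk (-c), ?_⟩
    rw [unitDouble_d_apply f X hk hnm', map_neg, hc', map_sub, hx₀]
    congr 2 <;> abel
  · have hnm' : 1 + n = m := by omega
    obtain ⟨k, hk⟩ : ∃ k, 1 + k = n := ⟨n - 1, by omega⟩
    obtain ⟨a, b, rfl⟩ := exists_unitDoubleInl_add_inr f Y hnm' t
    rw [unitDouble_d_apply f Y hnm' (add_comm 1 m)] at ht
    obtain ⟨ha, hb⟩ := unitDoubleInl_add_inr_inj f Y (add_comm 1 m) (x' := 0) (y' := 0)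
      (ht.trans (by simp))
    obtain ⟨x, w, hx, rfl⟩ := s n m hnm a ha
    -- For `(x, y₀)` to be a cocycle, `y₀` must be a primitive of the image of `x` in `B ⊗ X`; this
    -- leaves a cocycle as error in the second coordinate, which `sB` absorbs.
    obtain ⟨y₀, hy₀⟩ := iB n m hnm (unitMap f _ x) (b - unitMap f _ w)
      (by
        rw [hdX, hx, map_zero])
      (by
        rw [hu, map_sub, ← sub_eq_zero.1 hb, hdY, map_add]
        abel)
    obtain rfl := hnm
    obtain ⟨v, q, hv, hq⟩ := sB k n (by omega) (b - unitMap f _ w - (B ◁ φ.f n) y₀) (by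
      rw [map_sub, map_sub, hcB, hy₀, hu, hdY, ← sub_eq_zero.1 hb, map_add]
      abel)
    refine ⟨unitDoubleInl f X _ x + unitDoubleInr f X n _ hnm' (y₀ + v),
      unitDoubleInl f Y n w + unitDoubleInr f Y k n hk (-q), ?_, ?_⟩
    · rw [unitDouble_d_apply f X hnm' (add_comm 1 _), hx, map_add, hy₀, hv]
      simp
    · rw [unitDouble_whiskerLeft_apply, unitDouble_d_apply f Y hk hnm', add_add_add_comm,
        ← map_add, ← map_add, map_neg]
      congr 2
      rw [map_add, ← sub_eq_zero, ← sub_eq_zero.2 hq]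
      abel

/-- A morphism `K ⟶ X` killed by `X ⟶ B ⊗ X` lifts to the tensor product of `0 → R → B → 0`
and `X`. -/
noncomputable def unitDoubleLift {K : CochainComplex (ModuleCat.{u} R) ℤ} (ι : K ⟶ X)
    (hι : ∀ n, ι.f n ≫ unitMap f (X.X n) = 0) : K ⟶ unitDouble f ⊗ X where
  f n := ι.f n ≫ unitDoubleInl f X n
  comm' n m h := by
    have h' : 1 + n = m := by
      rw [add_comm]
      exact h
    rw [Category.assoc, unitDoubleInl_d f X n m h', Preadditive.comp_add, reassoc_of% (hι n),
      Limits.zero_comp, add_zero, ι.comm_assoc]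

/-- If `X ⟶ B ⊗ X` is surjective in each degree, then its kernel is quasi-isomorphic to the
tensor product of `0 → R → B → 0` and `X`. -/
theorem quasiIso_unitDoubleLift {K : CochainComplex (ModuleCat.{u} R) ℤ} (ι : K ⟶ X)
    (hι : ∀ n, ι.f n ≫ unitMap f (X.X n) = 0) (hinj : ∀ n, Function.Injective (ι.f n))
    (hker : ∀ n x, unitMap f (X.X n) x = 0 → ∃ z, ι.f n z = x)
    (hsurj : ∀ n, Function.Surjective (unitMap f (X.X n))) :
    QuasiIso (unitDoubleLift f ι hι) := by
  have hdX : ∀ n m (x : X.X n), (B ◁ X.d n m) (unitMap f _ x) = unitMap f _ (X.d n m x) :=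
    fun n m x => congr($(unitMap_naturality f (X.d n m)).hom x)
  have hc : ∀ n m (x : K.X n), X.d n m (ι.f n x) = ι.f m (K.d n m x) :=
    fun n m x => congr($(ι.comm n m).hom x)
  have hdd : ∀ n m k (x : X.X n), X.d m k (X.d n m x) = 0 :=
    fun n m k x => congr($(X.d_comp_d n m k).hom x)
  have hl : ∀ n m (h : 1 + n = m) z, (unitDoubleLift f ι hι).f m z =
      unitDoubleInl f X m (ι.f m z) + unitDoubleInr f X n m h 0 := fun n m h z => by
    rw [map_zero, add_zero]
    rfl
  refine (quasiIso_iff_cocycles _).2 ⟨fun n m hnm z v hz hv => ?_, fun n m hnm t ht => ?_⟩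
  · have hnm' : 1 + n = m := by omega
    obtain ⟨k, hk⟩ : ∃ k, 1 + k = n := ⟨n - 1, by omega⟩
    obtain ⟨a, b, rfl⟩ := exists_unitDoubleInl_add_inr f X hk v
    rw [unitDouble_d_apply f X hk hnm', hl n m hnm'] at hv
    obtain ⟨h₁, h₂⟩ := unitDoubleInl_add_inr_inj f X hnm' hv
    obtain ⟨b, rfl⟩ := hsurj _ b
    -- Lifting the second coordinate along `X → B ⊗ X` and subtracting its differential from `a`
    -- moves `a` into the kernel without changing `d a`.
    obtain ⟨w, hw⟩ := hker n (a - X.d k n b) (by rw [map_sub, ← hdX, ← h₂])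
    refine ⟨w, hinj m ?_⟩
    rw [← hc, hw, map_sub, hdd, sub_zero, h₁]
  · have hnm' : 1 + n = m := by omega
    obtain ⟨k, hk⟩ : ∃ k, 1 + k = n := ⟨n - 1, by omega⟩
    obtain ⟨a, b, rfl⟩ := exists_unitDoubleInl_add_inr f X hnm' t
    rw [unitDouble_d_apply f X hnm' (add_comm 1 m)] at ht
    obtain ⟨ha, hb⟩ := unitDoubleInl_add_inr_inj f X (add_comm 1 m) (x' := 0) (y' := 0)
      (ht.trans (by simp))
    obtain ⟨b, rfl⟩ := hsurj _ b
    -- After lifting the second coordinate to `b`, the cocycle minus the coboundary of `(b, 0)` has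
    -- only a first coordinate, which lies in the kernel.
    obtain ⟨z, hz⟩ := hker m (a - X.d n m b) (by rw [map_sub, ← hdX, hb])
    refine ⟨z, unitDoubleInl f X n b + unitDoubleInr f X k n hk 0, hinj _ ?_, ?_⟩
    · rw [← hc, hz, map_sub, hdd, ha, sub_zero, map_zero]
    · rw [hl n m hnm', unitDouble_d_apply f X hk hnm', hz,
        map_zero (ConcreteCategory.hom (B ◁ X.d k n)), sub_zero, add_add_add_comm, ← map_add,
        ← map_add]
      congr 2
      all_goals abel

end Cone

/-! ### Comparing the torsion functor with the Čech complex, by induction on generators. -/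

section Comparison

variable {R : Type u} [CommRing R]

theorem unitDoubleLift_naturality {B : ModuleCat.{u} R} (f : 𝟙_ (ModuleCat.{u} R) ⟶ B)
    {K K' X X' : CochainComplex (ModuleCat.{u} R) ℤ} (ι : K ⟶ X) (ι' : K' ⟶ X')
    (hι : ∀ n, ι.f n ≫ unitMap f (X.X n) = 0) (hι' : ∀ n, ι'.f n ≫ unitMap f (X'.X n) = 0)
    (ψ : K ⟶ K') (φ : X ⟶ X') (h : ψ ≫ ι' = ι ≫ φ) :
    ψ ≫ unitDoubleLift f ι' hι' = unitDoubleLift f ι hι ≫ (unitDouble f ◁ φ) := by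
  ext1 n
  change ψ.f n ≫ ι'.f n ≫ unitDoubleInl f X' n =
    (ι.f n ≫ unitDoubleInl f X n) ≫ (unitDouble f ◁ φ).f n
  rw [Category.assoc, unitDoubleInl_whiskerLeft, ← Category.assoc, ← Category.assoc]
  exact congr($(congr(HomologicalComplex.Hom.f $h n)) ≫ _)

variable (J : Ideal R)

/-- The unit `R ⟶ R_{a, J}` as a morphism in the category of modules. -/
noncomputable def cechUnit (a : R) :
    𝟙_ (ModuleCat.{u} R) ⟶ ModuleCat.of R (Localization (cechSubmonoid J a)) :=
  ModuleCat.ofHom (Algebra.linearMap R (Localization (cechSubmonoid J a)))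

theorem unitMap_cechUnit_apply (a : R) (M : ModuleCat.{u} R) (x : M) :
    unitMap (cechUnit J a) M x =
      TensorProduct.mk R (Localization (cechSubmonoid J a)) M 1 x := by
  change TensorProduct.tmul R (algebraMap R (Localization (cechSubmonoid J a)) 1) x = _
  rw [map_one]
  rfl

/-- The generalized Čech complex of a list of elements. -/
noncomputable def cechComplexList (l : List R) : CochainComplex (ModuleCat.{u} R) ℤ :=
  l.foldr (fun x K => cechComplexOne J x ⊗ K) (𝟙_ (CochainComplex (ModuleCat.{u} R) ℤ))

theorem quasiIso_cechComplexList_whiskerLeft (l : List R)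
    {X Y : CochainComplex (ModuleCat.{u} R) ℤ} (φ : X ⟶ Y) (hφ : QuasiIso φ) :
    QuasiIso (cechComplexList J l ◁ φ) := by
  induction l with
  | nil =>
    change QuasiIso (𝟙_ (CochainComplex (ModuleCat.{u} R) ℤ) ◁ φ)
    rw [id_whiskerLeft]
    infer_instance
  | cons a l ih =>
    change QuasiIso ((unitDouble (cechUnit J a) ⊗ cechComplexList J l) ◁ φ)
    rw [tensor_whiskerLeft]
    have : Module.Flat R (ModuleCat.of R (Localization (cechSubmonoid J a))) :=
      IsLocalization.flat _ (cechSubmonoid J a)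
    have := quasiIso_unitDouble_whiskerLeft (cechUnit J a) _ ih
    infer_instance

/-- The inclusion of torsion functors attached to an inclusion of ideals. -/
def torsionInclusion {I I' : Ideal R} (h : I ≤ I') : torsionFunctor I' J ⟶ torsionFunctor I J where
  app M := ModuleCat.ofHom (Submodule.inclusion (torsion_anti J h M))

theorem injective_torsionFunctor_obj [IsNoetherianRing R] (I : Ideal R) (M : ModuleCat.{u} R)
    [Injective M] : Module.Baer R ((torsionFunctor I J).obj M) :=
  baer_torsion I J (Module.Baer.of_injective (Module.injective_module_of_injective_object R M))

/-- The `(I, J)`-torsion of a complex of injective modules is quasi-isomorphic to its tensor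
product with the Čech complex of generators of `I`. -/
theorem exists_torsion_comparison [IsNoetherianRing R] (l : List R) :
    ∃ η : (torsionFunctor (Ideal.ofList l) J).mapHomologicalComplex (.up ℤ) ⟶
        tensorLeft (cechComplexList J l),
      ∀ X : CochainComplex (ModuleCat.{u} R) ℤ, (∀ n, Injective (X.X n)) →
        QuasiIso (η.app X) := by
  induction l with
  | nil =>
    let ι : torsionFunctor (Ideal.ofList ([] : List R)) J ⟶ 𝟭 (ModuleCat.{u} R) :=
      { app M := ModuleCat.ofHom (torsion _ J M).subtype }
    have hι : ∀ M, IsIso (ι.app M) := fun M => by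
      rw [ConcreteCategory.isIso_iff_bijective]
      refine ⟨Subtype.val_injective, fun x => ⟨⟨x, ?_⟩, rfl⟩⟩
      rw [Ideal.ofList_nil, torsion_bot]
      trivial
    have : IsIso ι := NatIso.isIso_of_isIso_app ι
    refine ⟨NatTrans.mapHomologicalComplex ι (.up ℤ) ≫
      (Functor.mapHomologicalComplexIdIso _ _).hom ≫ (leftUnitorNatIso _).inv, fun X _ => ?_⟩
    have h₁ : IsIso ((NatTrans.mapHomologicalComplex ι (.up ℤ)).app X) := by
      have : ∀ n, IsIso (((NatTrans.mapHomologicalComplex ι (.up ℤ)).app X).f n) :=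
        fun n => hι (X.X n)
      exact HomologicalComplex.Hom.isIso_of_components _
    have h₂ : IsIso (((Functor.mapHomologicalComplexIdIso (ModuleCat.{u} R) (.up ℤ)).hom ≫
      (leftUnitorNatIso (CochainComplex (ModuleCat.{u} R) ℤ)).inv).app X) := inferInstance
    have h₃ := IsIso.comp_isIso' h₁ h₂
    have hq : ∀ {K L : CochainComplex (ModuleCat.{u} R) ℤ} (g : K ⟶ L), IsIso g → QuasiIso g :=
      fun g _ => inferInstance
    exact hq _ h₃
  | cons a l ih =>
    obtain ⟨η, hη⟩ := ih
    have hle : Ideal.ofList l ≤ Ideal.ofList (a :: l) := by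
      rw [Ideal.ofList_cons]
      exact le_sup_right
    let ι := NatTrans.mapHomologicalComplex (torsionInclusion J hle) (.up ℤ)
    have hmem : ∀ (M : ModuleCat.{u} R) (x : M), x ∈ torsion (Ideal.ofList (a :: l)) J M ↔
        x ∈ torsion (Ideal.span {a}) J M ∧ x ∈ torsion (Ideal.ofList l) J M := fun M x => by
      rw [Ideal.ofList_cons, torsion_sup]
      rfl
    -- Being killed by an element of `S_{a,J}` does not depend on whether `x` is viewed in the
    -- submodule or in `M`.
    have htors : ∀ (M : ModuleCat.{u} R) (x : torsion (Ideal.ofList l) J M),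
        unitMap (cechUnit J a) ((torsionFunctor (Ideal.ofList l) J).obj M) x = 0 ↔
          (x : M) ∈ torsion (Ideal.ofList (a :: l)) J M := fun M x => by
      refine (Eq.congr_left (unitMap_cechUnit_apply J a
        ((torsionFunctor (Ideal.ofList l) J).obj M) x)).trans ?_
      refine (mk_eq_zero_iff J a x).trans ?_
      rw [hmem, and_iff_left x.2, mem_torsion_span_singleton_iff, mem_torsion_span_singleton_iff]
      exact exists_congr fun s => and_congr_right fun _ => Subtype.ext_iff
    have hι : ∀ X n, (ι.app X).f n ≫ unitMap (cechUnit J a) _ = 0 := fun X n => by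
      ext x
      exact (htors (X.X n) ((ι.app X).f n x)).2 x.2
    refine ⟨{ app X := unitDoubleLift (cechUnit J a) (ι.app X) (hι X) ≫
                (unitDouble (cechUnit J a) ◁ η.app X) ≫
                (α_ (unitDouble (cechUnit J a)) (cechComplexList J l) X).inv
              naturality X Y φ := ?_ }, fun X hX => ?_⟩
    · have key : (unitDouble (cechUnit J a) ◁ ((torsionFunctor (Ideal.ofList l)
          J).mapHomologicalComplex (.up ℤ)).map φ) ≫ (unitDouble (cechUnit J a) ◁ η.app Y) ≫
            (α_ (unitDouble (cechUnit J a)) (cechComplexList J l) Y).inv =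
          ((unitDouble (cechUnit J a) ◁ η.app X) ≫
            (α_ (unitDouble (cechUnit J a)) (cechComplexList J l) X).inv) ≫
              ((unitDouble (cechUnit J a) ⊗ cechComplexList J l) ◁ φ) := by
        rw [Category.assoc, ← associator_inv_naturality_right, ← whiskerLeft_comp_assoc,
          ← whiskerLeft_comp_assoc, η.naturality]
        rfl
      rw [← Category.assoc, unitDoubleLift_naturality (cechUnit J a) (ι.app X) (ι.app Y) (hι X)
        (hι Y) _ _ (ι.naturality φ), Category.assoc, Category.assoc]
      exact congrArg (unitDoubleLift (cechUnit J a) (ι.app X) (hι X) ≫ ·) key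
    · have h₁ : QuasiIso (unitDoubleLift (cechUnit J a) (ι.app X) (hι X)) := by
        refine quasiIso_unitDoubleLift _ _ _ (fun n => ?_) (fun n x hx => ?_) (fun n => ?_)
        · exact Submodule.inclusion_injective (torsion_anti J hle (X.X n))
        · exact ⟨⟨x.1, (htors (X.X n) x).1 hx⟩, rfl⟩
        -- Only this surjectivity needs `X` to be injective in each degree at this stage; it is used
        -- through the injectivity of the torsion submodule.
        · intro y
          have := hX n
          obtain ⟨x, hx⟩ := mk_surjective_of_baer (cechSubmonoid J a)
            (injective_torsionFunctor_obj J (Ideal.ofList l) (X.X n)) y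
          exact ⟨x, (unitMap_cechUnit_apply J a _ x).trans hx⟩
      have : Module.Flat R (ModuleCat.of R (Localization (cechSubmonoid J a))) :=
        IsLocalization.flat _ (cechSubmonoid J a)
      have h₂ := quasiIso_unitDouble_whiskerLeft (cechUnit J a) _ (hη X hX)
      change QuasiIso (unitDoubleLift (cechUnit J a) (ι.app X) (hι X) ≫
        (unitDouble (cechUnit J a) ◁ η.app X) ≫
          (α_ (unitDouble (cechUnit J a)) (cechComplexList J l) X).inv)
      infer_instance

end Comparison

/-- Pastes two naturality squares along a common edge, the form needed for isomorphisms built from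
zigzags. -/
theorem iso_trans_symm_naturality {C : Type*} [Category* C] {X X' Y Y' Z Z' : C} {x : X ⟶ X'}
    {y : Y ⟶ Y'} {z : Z ⟶ Z'} {p : X ≅ Y} {p' : X' ≅ Y'} {q : Z ≅ Y} {q' : Z' ≅ Y'}
    (hp : x ≫ p'.hom = p.hom ≫ y) (hq : z ≫ q'.hom = q.hom ≫ y) :
    x ≫ (p' ≪≫ q'.symm).hom = (p ≪≫ q.symm).hom ≫ z := by
  simp [reassoc_of% hp, ← (CommSq.mk hq.symm).horiz_inv.w]

/-! ### Additive functors and extension by zero, to pass from complexes over `ℕ` to complexes over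
`ℤ`. -/

section Extend

open HomologicalComplex

variable {C D : Type*} [Category* C] [Category* D] [Preadditive C] [Preadditive D]
  [Limits.HasZeroObject C] [Limits.HasZeroObject D] (F : C ⥤ D) [F.Additive]
  {ι ι' : Type*} {c : ComplexShape ι} {c' : ComplexShape ι'} (e : c.Embedding c')

open Classical in
/-- The degreewise isomorphisms underlying `mapExtendIso`. -/
noncomputable def mapExtendXIso (K : HomologicalComplex C c) (j : ι') :
    F.obj ((K.extend e).X j) ≅ (((F.mapHomologicalComplex c).obj K).extend e).X j :=
  if h : ∃ i, e.f i = j then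
    F.mapIso (K.extendXIso e h.choose_spec) ≪≫
      (((F.mapHomologicalComplex c).obj K).extendXIso e h.choose_spec).symm
  else
    (F.map_isZero (K.isZero_extend_X e j fun i hi => h ⟨i, hi⟩)).iso
      (isZero_extend_X _ e j fun i hi => h ⟨i, hi⟩)

/-- Frees the definition from its chosen preimage, which is unique because `e.f` is injective. -/
theorem mapExtendXIso_hom (K : HomologicalComplex C c) {i : ι} {j : ι'} (h : e.f i = j) :
    (mapExtendXIso F e K j).hom = F.map (K.extendXIso e h).hom ≫
      (((F.mapHomologicalComplex c).obj K).extendXIso e h).inv := by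
  have h' : ∃ i, e.f i = j := ⟨i, h⟩
  obtain rfl : h'.choose = i := e.injective_f (h'.choose_spec.trans h.symm)
  rw [mapExtendXIso, dif_pos h']
  rfl

/-- An additive functor commutes with the extension of complexes by zero. -/
noncomputable def mapExtendIso (K : HomologicalComplex C c) :
    (F.mapHomologicalComplex c').obj (K.extend e) ≅
      ((F.mapHomologicalComplex c).obj K).extend e :=
  Hom.isoOfComponents (mapExtendXIso F e K) fun j j' _ => by
    by_cases hj : ∃ i, e.f i = j
    · by_cases hj' : ∃ i, e.f i = j'
      · obtain ⟨i, hi⟩ := hj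
        obtain ⟨i', hi'⟩ := hj'
        rw [mapExtendXIso_hom F e K hi, mapExtendXIso_hom F e K hi']
        refine (iso_trans_symm_naturality (p := F.mapIso (K.extendXIso e hi))
          (p' := F.mapIso (K.extendXIso e hi')) (y := F.map (K.d i i'))
          (q := ((F.mapHomologicalComplex c).obj K).extendXIso e hi)
          (q' := ((F.mapHomologicalComplex c).obj K).extendXIso e hi') ?_ ?_).symm
        · simp [extend_d_eq _ e hi hi', ← Functor.map_comp]
        · exact (Iso.eq_comp_inv _).1 ((extend_d_eq _ e hi hi').trans (Category.assoc _ _ _).symm)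
      · exact (isZero_extend_X _ e j' fun i hi => hj' ⟨i, hi⟩).eq_of_tgt _ _
    · exact (F.map_isZero (K.isZero_extend_X e j fun i hi => hj ⟨i, hi⟩)).eq_of_src _ _

theorem mapExtendIso_hom_naturality {K L : HomologicalComplex C c} (φ : K ⟶ L) :
    (F.mapHomologicalComplex c').map (extendMap φ e) ≫ (mapExtendIso F e L).hom =
      (mapExtendIso F e K).hom ≫ extendMap ((F.mapHomologicalComplex c).map φ) e := by
  ext j
  change F.map ((extendMap φ e).f j) ≫ (mapExtendXIso F e L j).hom =
    (mapExtendXIso F e K j).hom ≫ (extendMap _ e).f j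
  by_cases hj : ∃ i, e.f i = j
  · obtain ⟨i, hi⟩ := hj
    rw [mapExtendXIso_hom F e K hi, mapExtendXIso_hom F e L hi]
    refine iso_trans_symm_naturality (p := F.mapIso (K.extendXIso e hi))
      (p' := F.mapIso (L.extendXIso e hi)) (y := F.map (φ.f i))
      (q := ((F.mapHomologicalComplex c).obj K).extendXIso e hi)
      (q' := ((F.mapHomologicalComplex c).obj L).extendXIso e hi) ?_ ?_
    · simp [extendMap_f _ e hi, ← Functor.map_comp]
    · exact (Iso.eq_comp_inv _).1 ((extendMap_f _ e hi).trans (Category.assoc _ _ _).symm)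
  · exact (F.map_isZero (K.isZero_extend_X e j fun i hi => hj ⟨i, hi⟩)).eq_of_src _ _

end Extend

/-! ### Right derived functors from injective resolutions indexed by `ℤ`. -/

section Resolution

variable {C D : Type*} [Category* C] [Category* D] [Abelian C] [Abelian D]
  [HasInjectiveResolutions C] (F : C ⥤ D) [F.Additive]

/-- The right derived functors computed by injective resolutions indexed by the integers. -/
noncomputable def rightDerivedObjIso {M : C} (P : InjectiveResolution M) (n : ℕ) :
    (F.rightDerived n).obj M ≅
      ((F.mapHomologicalComplex (.up ℤ)).obj P.cochainComplex).homology (n : ℤ) :=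
  P.isoRightDerivedObj F n ≪≫
    (HomologicalComplex.extendHomologyIso ((F.mapHomologicalComplex _).obj P.cocomplex)
      ComplexShape.embeddingUpNat (j := n) (j' := (n : ℤ)) rfl).symm ≪≫
    (HomologicalComplex.homologyFunctor D (.up ℤ) (n : ℤ)).mapIso
      (mapExtendIso F ComplexShape.embeddingUpNat P.cocomplex).symm

theorem rightDerivedObjIso_hom_naturality {M N : C} {P : InjectiveResolution M}
    {Q : InjectiveResolution N} {f : M ⟶ N} (φ : P.Hom Q f) (n : ℕ) :
    (F.rightDerived n).map f ≫ (rightDerivedObjIso F Q n).hom =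
      (rightDerivedObjIso F P n).hom ≫
        HomologicalComplex.homologyMap ((F.mapHomologicalComplex (.up ℤ)).map φ.hom') n := by
  have h₁ := InjectiveResolution.isoRightDerivedObj_hom_naturality f P Q φ.hom
    (by simpa using φ.ι_f_zero_comp_hom_f_zero) F n
  have h₂ := HomologicalComplex.extendHomologyIso_hom_naturality
    ((F.mapHomologicalComplex _).map φ.hom) ComplexShape.embeddingUpNat
    (j := n) (j' := (n : ℤ)) rfl
  have h₃ := mapExtendIso_hom_naturality F ComplexShape.embeddingUpNat φ.hom
  have h₃' := congr(HomologicalComplex.homologyMap $h₃ (n : ℤ))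
  rw [HomologicalComplex.homologyMap_comp, HomologicalComplex.homologyMap_comp] at h₃'
  have h := iso_trans_symm_naturality (iso_trans_symm_naturality h₁ h₂)
    (q := (HomologicalComplex.homologyFunctor D (.up ℤ) (n : ℤ)).mapIso (mapExtendIso F _ _))
    (q' := (HomologicalComplex.homologyFunctor D (.up ℤ) (n : ℤ)).mapIso (mapExtendIso F _ _)) h₃'
  rw [Iso.trans_assoc, Iso.trans_assoc] at h
  exact h

end Resolution

/-! ### The natural isomorphism on cohomology. -/

section Main

variable {R : Type u} [CommRing R] (J : Ideal R) (l : List R)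

/-- The torsion of an injective resolution computes the cohomology of the Čech complex. -/
noncomputable def torsionHomologyIso
    (η : (torsionFunctor (Ideal.ofList l) J).mapHomologicalComplex (.up ℤ) ⟶
      tensorLeft (cechComplexList J l))
    (hη : ∀ X : CochainComplex (ModuleCat.{u} R) ℤ, (∀ n, Injective (X.X n)) →
      QuasiIso (η.app X)) (i : ℤ) {M : ModuleCat.{u} R} (P : InjectiveResolution M) :
    (((torsionFunctor (Ideal.ofList l) J).mapHomologicalComplex (.up ℤ)).obj
      P.cochainComplex).homology i ≅ (tensorCohomology (cechComplexList J l) i).obj M :=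
  have := hη P.cochainComplex inferInstance
  have := quasiIso_cechComplexList_whiskerLeft J l P.ι' inferInstance
  isoOfQuasiIsoAt (η.app P.cochainComplex) i ≪≫
    (isoOfQuasiIsoAt (cechComplexList J l ◁ P.ι') i).symm

theorem torsionHomologyIso_hom_naturality
    (η : (torsionFunctor (Ideal.ofList l) J).mapHomologicalComplex (.up ℤ) ⟶
      tensorLeft (cechComplexList J l))
    (hη : ∀ X : CochainComplex (ModuleCat.{u} R) ℤ, (∀ n, Injective (X.X n)) →
      QuasiIso (η.app X)) (i : ℤ) {M N : ModuleCat.{u} R} {P : InjectiveResolution M}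
    {Q : InjectiveResolution N} {f : M ⟶ N} (φ : P.Hom Q f) :
    HomologicalComplex.homologyMap (((torsionFunctor (Ideal.ofList l) J).mapHomologicalComplex
        (.up ℤ)).map φ.hom') i ≫ (torsionHomologyIso J l η hη i Q).hom =
      (torsionHomologyIso J l η hη i P).hom ≫
        (tensorCohomology (cechComplexList J l) i).map f := by
  refine iso_trans_symm_naturality
    (y := HomologicalComplex.homologyMap (cechComplexList J l ◁ φ.hom') i) ?_ ?_
  · change _ ≫ HomologicalComplex.homologyMap _ i = HomologicalComplex.homologyMap _ i ≫ _
    rw [← HomologicalComplex.homologyMap_comp, η.naturality,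
      HomologicalComplex.homologyMap_comp]
    rfl
  · change HomologicalComplex.homologyMap (cechComplexList J l ◁
        (CochainComplex.singleFunctor (ModuleCat.{u} R) 0).map f) i ≫
          HomologicalComplex.homologyMap _ i = HomologicalComplex.homologyMap _ i ≫ _
    rw [← HomologicalComplex.homologyMap_comp, ← HomologicalComplex.homologyMap_comp,
      ← whiskerLeft_comp, ← whiskerLeft_comp, φ.ι'_comp_hom']

theorem nonempty_localCohomology_iso [IsNoetherianRing R] (i : ℤ) :
    Nonempty (localCohomology (Ideal.ofList l) J i ≅ tensorCohomology (cechComplexList J l) i) := by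
  obtain ⟨η, hη⟩ := exists_torsion_comparison J l
  obtain n | n := i
  · change Nonempty ((torsionFunctor (Ideal.ofList l) J).rightDerived n ≅
      tensorCohomology (cechComplexList J l) (n : ℤ))
    refine ⟨NatIso.ofComponents (fun M => rightDerivedObjIso _ (injectiveResolution M) n ≪≫
      torsionHomologyIso J l η hη n (injectiveResolution M)) fun {M N} f => ?_⟩
    -- Naturality in `M` is checked on a lift of `f` to the resolutions; any lift would do.
    let φ : (injectiveResolution M).Hom (injectiveResolution N) f :=
      ⟨InjectiveResolution.desc f _ _, by
        rw [← HomologicalComplex.comp_f, ← HomologicalComplex.comp_f,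
          InjectiveResolution.desc_commutes]⟩
    have h₁ := rightDerivedObjIso_hom_naturality (torsionFunctor (Ideal.ofList l) J) φ n
    have h₂ := torsionHomologyIso_hom_naturality J l η hη n φ
    rw [Iso.trans_hom, Iso.trans_hom, Category.assoc]
    rw [← h₂, reassoc_of% h₁]
  -- In negative degrees the Čech cohomology vanishes because the same comparison identifies it with
  -- the cohomology of the torsion of a resolution that is zero there.
  · have h₁ : ∀ M : ModuleCat.{u} R, Limits.IsZero
        ((tensorCohomology (cechComplexList J l) (.negSucc n)).obj M) := fun M => by
      refine Limits.IsZero.of_iso ?_ (torsionHomologyIso J l η hη _ (injectiveResolution M)).symm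
      refine ShortComplex.isZero_homology_of_isZero_X₂ _
        ((torsionFunctor (Ideal.ofList l) J).map_isZero ?_)
      exact CochainComplex.isZero_of_isStrictlyGE _ 0 _ (Int.negSucc_lt_zero n)
    have h₂ : Limits.IsZero (ModuleCat.of R PUnit.{u + 1}) := ModuleCat.isZero_of_subsingleton _
    exact ⟨NatIso.ofComponents (fun M => h₂.iso (h₁ M)) fun f => h₂.eq_of_src _ _⟩

end Main

end PairLocalCohomology

theorem theorem2p4 {R : Type u} [CommRing R] [IsNoetherianRing R] (I J : Ideal R)
    {s : ℕ} (a : Fin s → R) (ha : Ideal.span (Set.range a) = I) (i : ℤ) :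
    Nonempty (PairLocalCohomology.localCohomology I J i ≅
      PairLocalCohomology.tensorCohomology (PairLocalCohomology.cechComplex J a) i) := by
  have h : Ideal.ofList (List.ofFn a) = I := by
    rw [← ha, Ideal.ofList]
    congr 1
    ext x
    simp [List.mem_ofFn']
  rw [← h]
  exact PairLocalCohomology.nonempty_localCohomology_iso J (List.ofFn a) i
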